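/- Let $n\ge 1$, let $\mathbb H^n$ be the real hyperbolic space of dimension $n$ (constant curvature $-1$) with its Riemannian volume $dx$, let $a\in\mathbb H^n$, let $|x|_a$ denote the hyperbolic distance from $x$ to $a$, and let $B(a,r)=\{y\in\mathbb H^n: |y|_a<r\}$. Let $1<p\le q<\infty$, let $p'$ be the conjugate exponent, $\frac1p+\frac1{p'}=1$, and let $\alpha,\beta\in\mathbb R$. Then there is a constant $C>0$ such that the inequality $$\bigg(\int_{\mathbb H^n}\bigg(\int_{B(a,|x|_a)}|f(y)|\,dy\bigg)^q(\sinh|x|_a)^\alpha\,dx\bigg)^{\frac1q}\le C\bigg(\int_{\mathbb H^n}|f(x)|^p(\sinh|x|_a)^\beta\,dx\bigg)^{\frac1p}$$ (with both sides taking values in $[0,\infty]$) holds for all measurable functions $f:\mathbb H^n\to\mathbb C$ if and only if one of the following two conditions is satisfied: (A) $\alpha+n\ge 0$, $\alpha+n<1$, $\beta(1-p')+n>0$ and $\frac{\alpha+n}{q}+\frac{\beta(1-p')+n}{p'}\le\frac1q+\frac1{p'}$; (B) $\alpha+n<0$, $\beta(1-p')+n>0$ and $0\le\frac{\alpha+n}{q}+\frac{\beta(1-p')+n}{p'}\le\frac1q+\frac1{p'}$.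 -/

import Mathlib

open MeasureTheory
open scoped ENNReal

/-- Real hyperbolic space `ℍⁿ` (curvature `-1`) in the hyperboloid model: the points
`(t, x) ∈ ℝ × ℝⁿ` with `-t² + ‖x‖² = -1` on the upper sheet `t > 0` of Minkowski space. -/
structure HyperbolicSpace (n : ℕ) where
  time : ℝ
  space : EuclideanSpace ℝ (Fin n)
  mem_hyperboloid : -time ^ 2 + ‖space‖ ^ 2 = -1
  time_pos : 0 < time

namespace HyperbolicSpace

/-- The geodesic distance of `ℍⁿ`: `cosh d(a, b) = -⟨a, b⟩`, where
`⟨a, b⟩ = -a₀ b₀ + a₁ b₁ + ⋯ + aₙ bₙ` is the Minkowski form. -/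
noncomputable instance (n : ℕ) : Dist (HyperbolicSpace n) where
  dist a b := Real.arcosh (a.time * b.time - inner ℝ a.space b.space)

/-- The open geodesic ball `B(a, r)`. -/
def ball {n : ℕ} (a : HyperbolicSpace n) (r : ℝ) : Set (HyperbolicSpace n) :=
  {y | dist a y < r}

/-- The Borel σ-algebra of the hyperboloid, as a subset of `ℝ × ℝⁿ`. -/
instance (n : ℕ) : MeasurableSpace (HyperbolicSpace n) :=
  MeasurableSpace.comap (fun a => (a.time, a.space)) inferInstance

/-- The global parametrization `x ↦ (√(1 + ‖x‖²), x)` of the hyperboloid by `ℝⁿ`. -/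
noncomputable def ofSpace {n : ℕ} (x : EuclideanSpace ℝ (Fin n)) : HyperbolicSpace n where
  time := √(1 + ‖x‖ ^ 2)
  space := x
  mem_hyperboloid := by
    rw [Real.sq_sqrt (by positivity)]
    ring
  time_pos := by positivity

theorem measurable_ofSpace {n : ℕ} : Measurable (ofSpace (n := n)) := by
  refine Measurable.of_comap_le ?_
  rw [instMeasurableSpace, MeasurableSpace.comap_comp]
  refine Measurable.comap_le ?_
  have h : Continuous fun x : EuclideanSpace ℝ (Fin n) => (√(1 + ‖x‖ ^ 2), x) := by fun_prop
  exact h.measurable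

/-- The Riemannian metric in the coordinates `ofSpace`: the Minkowski form of the coordinate tangent
vectors `∂ᵢ = (xᵢ / √(1 + ‖x‖²), eᵢ)`, that is, `gᵢⱼ = δᵢⱼ - xᵢ xⱼ / (1 + ‖x‖²)`. -/
noncomputable def metricTensor {n : ℕ} (x : EuclideanSpace ℝ (Fin n)) :
    Matrix (Fin n) (Fin n) ℝ :=
  Matrix.of fun i j => (if i = j then 1 else 0) - x i * x j / (1 + ‖x‖ ^ 2)

/-- The Riemannian volume measure `√(det g) dx₁ ⋯ dxₙ`. -/
noncomputable instance (n : ℕ) : MeasureSpace (HyperbolicSpace n) where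
  volume := Measure.map ofSpace
    ((volume : Measure (EuclideanSpace ℝ (Fin n))).withDensity fun x =>
      ENNReal.ofReal √(metricTensor x).det)

end HyperbolicSpace

/-! Everything depends only on `S = sinh (dist a ·)`. In the coordinates `ofSpace` the volume is `dx
/ height x`, and a Lorentz reflection carrying `a` to the base point preserves it. Polar coordinates
then give `S` the law `c t ^ (n - 1) / √(1 + t ^ 2) dt` (`exists_lintegral_sinh_dist_eq`). Balls
become sublevel sets of `S`, so the claim is a weighted Hardy inequality for any function with this
law, `RadialHardy.hardy_iff`. Write `x = α + n` and `γ = β (1 - p') + n`.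

Sufficiency (`exists_hardy_le`) is a Schur-type argument. Hölder's inequality with an auxiliary
weight bounds the inner integral of `f`; since `p ≤ q`, the surplus power `q / p - 1` is paid for by
the full norm of `f`; Tonelli's theorem then leaves a tail integral that cancels the auxiliary
weight. Since the law has different power behaviour at `0` and at infinity, the weights are `twoPow`
functions with one exponent for each end. The conditions `0 < γ` and `x < 1` leave room for such a
weight; the lower balance condition is used near `0` and the upper one at infinity.

Necessity tests the inequality on the dual weight cut off to an annulus (`powMass_le_of_hardy_le`).
The resulting Muckenhoupt-type bound fails logarithmically if `1 ≤ x` or `γ ≤ 0`, and on adjacent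
dyadic annuli it forces the two balance conditions (`conditions_of_powMass_le`). -/

namespace HyperbolicSpace

open Set

variable {n : ℕ}

/-! ### Hyperbolic volume in the hyperboloid coordinates -/

theorem det_metricTensor (x : EuclideanSpace ℝ (Fin n)) :
    (metricTensor x).det = (1 + ‖x‖ ^ 2)⁻¹ := by
  have h : metricTensor x = 1 + Matrix.replicateCol Unit (fun i => - x i / (1 + ‖x‖ ^ 2)) *
      Matrix.replicateRow Unit (fun i => x i) := by
    ext i j
    simp [metricTensor, Matrix.mul_apply, Matrix.one_apply]
    ring
  have hx : ∑ i, x i * x i = ‖x‖ ^ 2 := by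
    rw [EuclideanSpace.real_norm_sq_eq]
    simp [sq]
  rw [h, Matrix.det_one_add_replicateCol_mul_replicateRow]
  simp only [dotProduct]
  have : ∑ i, x i * (-x i / (1 + ‖x‖ ^ 2)) = - ‖x‖ ^ 2 / (1 + ‖x‖ ^ 2) := by
    rw [← hx, ← Finset.sum_neg_distrib, Finset.sum_div]
    exact Finset.sum_congr rfl fun i _ => by ring
  rw [this]
  have : 1 + ‖x‖ ^ 2 ≠ 0 := by positivity
  field_simp
  ring

/-- The time coordinate of the point of the hyperboloid above `x`. -/
noncomputable def height (x : EuclideanSpace ℝ (Fin n)) : ℝ := √(1 + ‖x‖ ^ 2)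

theorem height_pos (x : EuclideanSpace ℝ (Fin n)) : 0 < height x := by
  unfold height; positivity

theorem height_sq (x : EuclideanSpace ℝ (Fin n)) : height x ^ 2 = 1 + ‖x‖ ^ 2 :=
  Real.sq_sqrt (by positivity)

theorem continuous_height : Continuous (height (n := n)) := by
  unfold height; fun_prop

theorem lintegral_volume {F : HyperbolicSpace n → ℝ≥0∞} (hF : Measurable F) :
    ∫⁻ x, F x = ∫⁻ x, ENNReal.ofReal (height x)⁻¹ * F (ofSpace x) := by
  have hm : Measurable fun x : EuclideanSpace ℝ (Fin n) => ENNReal.ofReal (height x)⁻¹ :=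
    (continuous_height.inv₀ fun x => (height_pos x).ne').measurable.ennreal_ofReal
  have hd : (fun x : EuclideanSpace ℝ (Fin n) => ENNReal.ofReal √(metricTensor x).det) =
      fun x => ENNReal.ofReal (height x)⁻¹ := by
    funext x
    rw [det_metricTensor, Real.sqrt_inv, height]
  have hv : (volume : Measure (HyperbolicSpace n)) = Measure.map ofSpace
      ((volume : Measure (EuclideanSpace ℝ (Fin n))).withDensity fun x =>
        ENNReal.ofReal (height x)⁻¹) := by
    rw [← hd]; rfl
  rw [hv, lintegral_map hF measurable_ofSpace]
  exact lintegral_withDensity_eq_lintegral_mul _ hm (hF.comp measurable_ofSpace)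

instance : SFinite (volume : Measure (HyperbolicSpace n)) :=
  inferInstanceAs (SFinite (Measure.map ofSpace
    ((volume : Measure (EuclideanSpace ℝ (Fin n))).withDensity fun x =>
      ENNReal.ofReal √(metricTensor x).det)))

theorem measurable_time_space :
    Measurable fun x : HyperbolicSpace n => (x.time, x.space) :=
  comap_measurable _

theorem norm_space_sq (a : HyperbolicSpace n) : ‖a.space‖ ^ 2 = a.time ^ 2 - 1 := by
  linarith [a.mem_hyperboloid]

theorem one_le_time (a : HyperbolicSpace n) : 1 ≤ a.time := by
  nlinarith [a.mem_hyperboloid, a.time_pos, sq_nonneg ‖a.space‖]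

theorem measurable_dist (a : HyperbolicSpace n) : Measurable fun x => dist a x := by
  have h : Measurable fun z : ℝ × EuclideanSpace ℝ (Fin n) =>
      Real.arcosh (a.time * z.1 - inner ℝ a.space z.2) := by
    unfold Real.arcosh
    have : Measurable fun z : ℝ × EuclideanSpace ℝ (Fin n) =>
        a.time * z.1 - inner ℝ a.space z.2 :=
      (by fun_prop : Continuous _).measurable
    fun_prop
  exact h.comp measurable_time_space

/-! ### Moving the centre to the base point -/

/-- The Lorentz reflection exchanging `a` and the base point `(1, 0)`, read in the coordinates
`ofSpace`. -/
noncomputable def reflect (a : HyperbolicSpace n) (x : EuclideanSpace ℝ (Fin n)) :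
    EuclideanSpace ℝ (Fin n) :=
  x + (height x - inner ℝ a.space x / (a.time - 1)) • a.space

section reflect

variable {a : HyperbolicSpace n}

theorem inner_lt_time_mul_height (a : HyperbolicSpace n) (x : EuclideanSpace ℝ (Fin n)) :
    inner ℝ a.space x < a.time * height x := by
  have h1 := real_inner_le_norm a.space x
  have h2 : ‖a.space‖ < a.time := by
    nlinarith [norm_space_sq a, norm_nonneg a.space, a.time_pos]
  have h3 : ‖x‖ < height x := by
    nlinarith [height_sq x, norm_nonneg x, height_pos x]
  nlinarith [norm_nonneg a.space, norm_nonneg x, height_pos x, a.time_pos]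

/-- The right side is the argument of `arcosh` in the distance from `a`: after reflecting, distance
to `a` is distance to the base point. -/
theorem height_reflect (ha : 1 < a.time) (x : EuclideanSpace ℝ (Fin n)) :
    height (reflect a x) = a.time * height x - inner ℝ a.space x := by
  have hk : a.time - 1 ≠ 0 := by linarith
  have hpos := inner_lt_time_mul_height a x
  rw [height, Real.sqrt_eq_iff_mul_self_eq_of_pos (by linarith), ← sq, reflect,
    norm_add_sq_real, norm_smul, mul_pow, norm_space_sq, inner_smul_right, Real.norm_eq_abs,
    sq_abs, real_inner_comm]
  have hx : ‖x‖ ^ 2 = height x ^ 2 - 1 := by rw [height_sq]; ring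
  rw [hx]
  field_simp
  ring

theorem inner_space_reflect (x : EuclideanSpace ℝ (Fin n)) :
    inner ℝ a.space (reflect a x) = inner ℝ a.space x +
      (height x - inner ℝ a.space x / (a.time - 1)) * (a.time ^ 2 - 1) := by
  rw [reflect, inner_add_right, inner_smul_right, real_inner_self_eq_norm_sq, norm_space_sq]

theorem reflect_reflect (ha : 1 < a.time) (x : EuclideanSpace ℝ (Fin n)) :
    reflect a (reflect a x) = x := by
  have hk : a.time - 1 ≠ 0 := by linarith
  have h : height (reflect a x) - inner ℝ a.space (reflect a x) / (a.time - 1) =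
      -(height x - inner ℝ a.space x / (a.time - 1)) := by
    rw [height_reflect ha, inner_space_reflect]
    field_simp
    ring
  rw [reflect, h, neg_smul, reflect]
  abel

/-- The derivative of `reflect a`. -/
noncomputable def reflectDeriv (a : HyperbolicSpace n) (x : EuclideanSpace ℝ (Fin n)) :
    EuclideanSpace ℝ (Fin n) →L[ℝ] EuclideanSpace ℝ (Fin n) :=
  ContinuousLinearMap.id ℝ _ + ((height x)⁻¹ • innerSL ℝ x -
    (a.time - 1)⁻¹ • innerSL ℝ a.space).smulRight a.space

theorem hasFDerivAt_height (x : EuclideanSpace ℝ (Fin n)) :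
    HasFDerivAt height ((height x)⁻¹ • innerSL ℝ x) x := by
  have h1 : HasFDerivAt (fun x : EuclideanSpace ℝ (Fin n) => 1 + ‖x‖ ^ 2)
      (2 • innerSL ℝ x) x := by
    simpa using ((hasStrictFDerivAt_norm_sq x).hasFDerivAt).const_add 1
  have h2 := h1.sqrt (by positivity)
  convert! h2 using 1
  ext y
  simp [height]
  field_simp

theorem hasFDerivAt_reflect (x : EuclideanSpace ℝ (Fin n)) :
    HasFDerivAt (reflect a) (reflectDeriv a x) x := by
  have h1 : HasFDerivAt (fun x : EuclideanSpace ℝ (Fin n) => inner ℝ a.space x / (a.time - 1))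
      ((a.time - 1)⁻¹ • innerSL ℝ a.space) x := by
    have := ((innerSL ℝ a.space).hasFDerivAt (x := x)).const_smul (a.time - 1)⁻¹
    convert! this using 1
    ext y
    simp [div_eq_inv_mul]
  exact (hasFDerivAt_id x).add (((hasFDerivAt_height x).sub h1).smul_const a.space)

/-- The derivative is a rank-one perturbation of the identity, with determinant `1` plus the
functional evaluated at `a.space`. This Jacobian is exactly what makes `dx / height x` invariant. -/
theorem abs_det_reflectDeriv (ha : 1 < a.time) (x : EuclideanSpace ℝ (Fin n)) :
    |(reflectDeriv a x).det| = height (reflect a x) / height x := by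
  have hk : a.time - 1 ≠ 0 := by linarith
  have hx := height_pos x
  have h : (reflectDeriv a x : EuclideanSpace ℝ (Fin n) →ₗ[ℝ] EuclideanSpace ℝ (Fin n)) =
      LinearMap.transvection (((height x)⁻¹ • innerSL ℝ x -
        (a.time - 1)⁻¹ • innerSL ℝ a.space : EuclideanSpace ℝ (Fin n) →L[ℝ] ℝ) :
          EuclideanSpace ℝ (Fin n) →ₗ[ℝ] ℝ) a.space := by
    ext y : 1
    simp [reflectDeriv, LinearMap.transvection.apply]
  have hdet : (reflectDeriv a x).det = -(height (reflect a x) / height x) := by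
    rw [ContinuousLinearMap.det, h, LinearMap.transvection.det, height_reflect ha]
    have : inner ℝ a.space a.space = a.time ^ 2 - 1 := by
      rw [real_inner_self_eq_norm_sq, norm_space_sq]
    simp only [ContinuousLinearMap.coe_coe, sub_apply,
      smul_apply, innerSL_apply_apply, smul_eq_mul, this]
    rw [real_inner_comm]
    field_simp
    ring
  rw [hdet, abs_neg, abs_of_pos (div_pos (height_pos _) hx)]

theorem lintegral_reflect (ha : 1 < a.time) (g : EuclideanSpace ℝ (Fin n) → ℝ≥0∞) :
    ∫⁻ x, ENNReal.ofReal (height x)⁻¹ * g (reflect a x) =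
      ∫⁻ x, ENNReal.ofReal (height x)⁻¹ * g x := by
  have hinv : Function.Involutive (reflect a) := reflect_reflect ha
  have h := lintegral_image_eq_lintegral_abs_det_fderiv_mul volume MeasurableSet.univ
    (fun x _ => (hasFDerivAt_reflect (a := a) x).hasFDerivWithinAt) hinv.injective.injOn
    (fun x => ENNReal.ofReal (height x)⁻¹ * g x)
  rw [image_univ, hinv.surjective.range_eq, setLIntegral_univ, setLIntegral_univ] at h
  rw [h]
  refine lintegral_congr fun x => ?_
  have h1 := height_pos x
  have h2 := height_pos (reflect a x)
  rw [abs_det_reflectDeriv ha, ← mul_assoc, ← ENNReal.ofReal_mul (by positivity)]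
  congr 2
  field_simp

end reflect

theorem sinh_arcosh_height (x : EuclideanSpace ℝ (Fin n)) :
    Real.sinh (Real.arcosh (height x)) = ‖x‖ := by
  have h : 1 ≤ height x := by
    nlinarith [height_sq x, height_pos x, sq_nonneg ‖x‖]
  rw [Real.sinh_arcosh h, height_sq, add_sub_cancel_left, Real.sqrt_sq (norm_nonneg x)]

theorem dist_ofSpace (a : HyperbolicSpace n) (x : EuclideanSpace ℝ (Fin n)) :
    dist a (ofSpace x) = Real.arcosh (a.time * height x - inner ℝ a.space x) := rfl

theorem lintegral_sinh_dist_eq_lintegral_norm (a : HyperbolicSpace n) {φ : ℝ → ℝ≥0∞}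
    (hφ : Measurable φ) :
    ∫⁻ x, φ (Real.sinh (dist a x)) =
      ∫⁻ x : EuclideanSpace ℝ (Fin n), ENNReal.ofReal (height x)⁻¹ * φ ‖x‖ := by
  rw [lintegral_volume (F := fun x => φ (Real.sinh (dist a x)))
    (hφ.comp (Real.measurable_sinh.comp (measurable_dist a)))]
  -- When `a` is the base point, the reflection formula divides by `a.time - 1 = 0`, but then no
  -- reflection is needed.
  rcases (one_le_time a).eq_or_lt with ha | ha
  · have h0 : a.space = 0 := by
      have := norm_space_sq a
      rw [← ha] at this
      simpa using this
    refine lintegral_congr fun x => ?_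
    rw [dist_ofSpace, ← ha, h0, inner_zero_left, one_mul, sub_zero, sinh_arcosh_height]
  · rw [← lintegral_reflect ha fun x => φ ‖x‖]
    refine lintegral_congr fun x => ?_
    rw [dist_ofSpace, ← height_reflect ha, sinh_arcosh_height]

end HyperbolicSpace

/-! ### Polar coordinates -/

theorem MeasureTheory.Measure.lintegral_fun_norm_addHaar {E : Type*} [NormedAddCommGroup E]
    [NormedSpace ℝ E] [FiniteDimensional ℝ E] [Nontrivial E] [MeasurableSpace E] [BorelSpace E]
    (μ : Measure E) [μ.IsAddHaarMeasure] {φ : ℝ → ℝ≥0∞} (hφ : Measurable φ) :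
    ∫⁻ x, φ ‖x‖ ∂μ = μ.toSphere Set.univ *
      ∫⁻ t in Set.Ioi (0 : ℝ), ENNReal.ofReal (t ^ (Module.finrank ℝ E - 1)) * φ t := by
  have h1 : ∫⁻ x, φ ‖x‖ ∂μ = ∫⁻ x : ({(0)}ᶜ : Set E), φ (‖x.1‖) ∂(μ.comap (↑)) := by
    rw [lintegral_subtype_comap (measurableSet_singleton _).compl fun x => φ ‖x‖,
      restrict_compl_singleton]
  have h2 := μ.measurePreserving_homeomorphUnitSphereProd.lintegral_comp_emb
    (Homeomorph.measurableEmbedding _) (φ ∘ Subtype.val ∘ Prod.snd)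
  simp only [Function.comp_apply, homeomorphUnitSphereProd_apply_snd_coe] at h2
  rw [h1, h2, lintegral_prod _ (by fun_prop)]
  simp only [lintegral_const]
  rw [mul_comm, Measure.volumeIoiPow, lintegral_withDensity_eq_lintegral_mul _ (by fun_prop)
    (by fun_prop)]
  congr 1
  exact lintegral_subtype_comap measurableSet_Ioi
    fun a : ℝ => ENNReal.ofReal (a ^ (Module.finrank ℝ E - 1)) * φ a

namespace HyperbolicSpace

/-- Integration in geodesic polar coordinates around `a`, in the variable `t = sinh r`. -/
theorem exists_lintegral_sinh_dist_eq {n : ℕ} (hn : 1 ≤ n) (a : HyperbolicSpace n) :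
    ∃ c : ℝ≥0∞, c ≠ 0 ∧ c ≠ ⊤ ∧ ∀ φ : ℝ → ℝ≥0∞, Measurable φ →
      ∫⁻ x, φ (Real.sinh (dist a x)) = c * ∫⁻ t in Set.Ioi (0 : ℝ),
        ENNReal.ofReal (t ^ ((n : ℝ) - 1) * (√(1 + t ^ 2))⁻¹) * φ t := by
  have : Nonempty (Fin n) := ⟨⟨0, hn⟩⟩
  refine ⟨(volume : Measure (EuclideanSpace ℝ (Fin n))).toSphere Set.univ, ?_, ?_, ?_⟩
  · exact (Measure.measure_univ_ne_zero).2 (Measure.toSphere_ne_zero _)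
  · exact measure_ne_top _ _
  · intro φ hφ
    simp only [lintegral_sinh_dist_eq_lintegral_norm a hφ, height]
    rw [Measure.lintegral_fun_norm_addHaar volume
      (φ := fun t => ENNReal.ofReal (√(1 + t ^ 2))⁻¹ * φ t) (by fun_prop)]
    congr 1
    refine setLIntegral_congr_fun measurableSet_Ioi fun t ht => ?_
    have ht : 0 < t := ht
    rw [finrank_euclideanSpace_fin, ← mul_assoc, ← ENNReal.ofReal_mul (by positivity),
      ← Real.rpow_natCast, Nat.cast_sub hn, Nat.cast_one]

end HyperbolicSpace

/-! ### Calculus of two-power weights -/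

namespace RadialHardy

open Set

/-- The weight `t ^ a * (1 + t) ^ b`, which behaves like `t ^ a` at `0` and like `t ^ (a + b)`
at infinity. -/
noncomputable def twoPow (a b t : ℝ) : ℝ := t ^ a * (1 + t) ^ b

theorem twoPow_pos {a b t : ℝ} (ht : 0 < t) : 0 < twoPow a b t := by
  unfold twoPow; positivity

theorem twoPow_zero_right {a t : ℝ} : twoPow a 0 t = t ^ a := by
  simp [twoPow]

theorem twoPow_mul {a b a' b' t : ℝ} (ht : 0 < t) :
    twoPow a b t * twoPow a' b' t = twoPow (a + a') (b + b') t := by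
  unfold twoPow
  rw [Real.rpow_add ht, Real.rpow_add (by linarith)]
  ring

theorem twoPow_rpow {a b r t : ℝ} (ht : 0 < t) :
    twoPow a b t ^ r = twoPow (a * r) (b * r) t := by
  unfold twoPow
  rw [Real.mul_rpow (by positivity) (by positivity), ← Real.rpow_mul ht.le,
    ← Real.rpow_mul (by linarith)]

/-- Lowering the exponent at `0` and raising the one at infinity can only enlarge the weight. -/
theorem twoPow_le_twoPow {a b a' b' t : ℝ} (ht : 0 < t) (h0 : a' ≤ a) (h1 : a + b ≤ a' + b') :
    twoPow a b t ≤ twoPow a' b' t := by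
  have e1 : twoPow a b t = t ^ a' * (t ^ (a - a') * (1 + t) ^ b) := by
    rw [twoPow, ← mul_assoc, ← Real.rpow_add ht]; congr 2; ring
  have e2 : t ^ (a - a') * (1 + t) ^ b ≤ (1 + t) ^ b' := by
    calc t ^ (a - a') * (1 + t) ^ b ≤ (1 + t) ^ (a - a') * (1 + t) ^ b := by
          gcongr; linarith
      _ = (1 + t) ^ (a - a' + b) := by rw [Real.rpow_add (by linarith)]
      _ ≤ (1 + t) ^ b' := Real.rpow_le_rpow_of_exponent_le (by linarith) (by linarith)
  rw [e1, twoPow]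
  gcongr

theorem measurable_twoPow (a b : ℝ) : Measurable (twoPow a b) := by
  unfold twoPow; fun_prop

theorem one_add_rpow_le {s t : ℝ} (b : ℝ) (hs : 0 < s) (ht : 0 < t) :
    (1 + t) ^ b ≤ (1 + s) ^ b * (1 + (t / s) ^ b) := by
  have hq : 0 < (t / s) ^ b := by positivity
  have hp : 0 < (1 + s) ^ b := by positivity
  suffices h : (1 + t) ^ b ≤ (1 + s) ^ b ∨ (1 + t) ^ b ≤ ((1 + s) * (t / s)) ^ b by
    rcases h with h | h
    · nlinarith
    · rw [Real.mul_rpow (by positivity) (by positivity)] at h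
      nlinarith
  have hmul : (1 + s) * (t / s) = t / s + t := by field_simp
  rcases le_total s t with hst | hst <;> rcases le_total 0 b with hb | hb
  · right
    have : 1 ≤ t / s := (one_le_div hs).2 hst
    exact Real.rpow_le_rpow (by linarith) (by linarith) hb
  · left
    exact Real.rpow_le_rpow_of_nonpos (by linarith) (by linarith) hb
  · left
    exact Real.rpow_le_rpow (by linarith) (by linarith) hb
  · right
    have : t / s ≤ 1 := (div_le_one hs).2 hst
    exact Real.rpow_le_rpow_of_nonpos (by positivity) (by linarith) hb

/-- Two pure powers of `t` dominate the weight, and at `t = s` their sum is exactly twice it.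
Integrals over `(0, s)` and `(s, ∞)` thus reduce to explicit ones, with no splitting at `t = 1`. -/
theorem twoPow_le_add {a b s t : ℝ} (hs : 0 < s) (ht : 0 < t) :
    twoPow a b t ≤ (1 + s) ^ b * t ^ a + (1 + s) ^ b * s ^ (-b) * t ^ (a + b) := by
  have h := mul_le_mul_of_nonneg_left (one_add_rpow_le b hs ht) (Real.rpow_nonneg ht.le a)
  rw [twoPow]
  refine h.trans_eq ?_
  rw [Real.div_rpow ht.le hs.le, Real.rpow_add ht, Real.rpow_neg hs.le]
  field_simp

/-- With both end exponents nonnegative the weight is nondecreasing; the factor `2` is only the cost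
of using `twoPow_le_add`. -/
theorem twoPow_le_two_mul {a b s t : ℝ} (ht : 0 < t) (hts : t ≤ s) (ha : 0 ≤ a)
    (hab : 0 ≤ a + b) : twoPow a b t ≤ 2 * twoPow a b s := by
  have hs : 0 < s := by linarith
  refine (twoPow_le_add hs ht).trans ?_
  have h1 : t ^ a ≤ s ^ a := by gcongr
  have h2 : t ^ (a + b) ≤ s ^ a * s ^ b := by
    rw [← Real.rpow_add hs]; gcongr
  have h3 : s ^ (-b) * s ^ b = 1 := by rw [← Real.rpow_add hs]; simp
  have h4 : s ^ (-b) * t ^ (a + b) ≤ s ^ a :=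
    calc s ^ (-b) * t ^ (a + b) ≤ s ^ (-b) * (s ^ a * s ^ b) := by gcongr
      _ = s ^ a := by linear_combination s ^ a * h3
  have h5 : 0 < (1 + s) ^ b := by positivity
  unfold twoPow
  nlinarith

theorem lintegral_Ioo_rpow {e s : ℝ} (he : 0 < e) (hs : 0 < s) :
    ∫⁻ t in Ioo 0 s, ENNReal.ofReal (t ^ (e - 1)) = ENNReal.ofReal (s ^ e / e) := by
  rw [← ofReal_integral_eq_lintegral_ofReal
    ((intervalIntegral.integrableOn_Ioo_rpow_iff hs).2 (by linarith)),
    ← integral_Ioc_eq_integral_Ioo, ← intervalIntegral.integral_of_le hs.le,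
    integral_rpow (Or.inl (by linarith))]
  · rw [sub_add_cancel, Real.zero_rpow he.ne', sub_zero]
  · filter_upwards [ae_restrict_mem measurableSet_Ioo] with t ht
    exact Real.rpow_nonneg ht.1.le _

theorem lintegral_Ioi_rpow {e s : ℝ} (he : e < 0) (hs : 0 < s) :
    ∫⁻ t in Ioi s, ENNReal.ofReal (t ^ (e - 1)) = ENNReal.ofReal (s ^ e / -e) := by
  rw [← ofReal_integral_eq_lintegral_ofReal
    ((integrableOn_Ioi_rpow_iff hs).2 (by linarith)), integral_Ioi_rpow_of_lt (by linarith) hs]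
  · rw [sub_add_cancel, neg_div, div_neg]
  · filter_upwards [ae_restrict_mem measurableSet_Ioi] with t ht
    exact Real.rpow_nonneg (hs.trans ht).le _

theorem lintegral_twoPow_le {I : Set ℝ} (hI : MeasurableSet I) (hI0 : I ⊆ Ioi 0) {a b s k l : ℝ}
    (hs : 0 < s) (hk : 0 ≤ k) (hl : 0 ≤ l)
    (h1 : ∫⁻ t in I, ENNReal.ofReal (t ^ (a - 1)) = ENNReal.ofReal (s ^ a * k))
    (h2 : ∫⁻ t in I, ENNReal.ofReal (t ^ (a + b - 1)) = ENNReal.ofReal (s ^ (a + b) * l)) :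
    ∫⁻ t in I, ENNReal.ofReal (twoPow (a - 1) b t) ≤
      ENNReal.ofReal ((k + l) * twoPow a b s) := by
  calc ∫⁻ t in I, ENNReal.ofReal (twoPow (a - 1) b t)
      ≤ ∫⁻ t in I, (ENNReal.ofReal ((1 + s) ^ b) * ENNReal.ofReal (t ^ (a - 1)) +
          ENNReal.ofReal ((1 + s) ^ b * s ^ (-b)) * ENNReal.ofReal (t ^ (a + b - 1))) := by
        refine setLIntegral_mono' hI fun t ht => ?_
        have ht : 0 < t := hI0 ht
        rw [← ENNReal.ofReal_mul (by positivity), ← ENNReal.ofReal_mul (by positivity),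
          ← ENNReal.ofReal_add (by positivity) (by positivity)]
        refine ENNReal.ofReal_le_ofReal ((twoPow_le_add hs ht).trans_eq ?_)
        congr 3
        ring
    _ = _ := by
        rw [lintegral_add_left (by fun_prop), lintegral_const_mul _ (by fun_prop),
          lintegral_const_mul _ (by fun_prop), h1, h2, ← ENNReal.ofReal_mul (by positivity),
          ← ENNReal.ofReal_mul (by positivity),
          ← ENNReal.ofReal_add (by positivity) (by positivity)]
        congr 1
        have h3 : s ^ (-b) * s ^ b = 1 := by rw [← Real.rpow_add hs]; simp
        rw [Real.rpow_add hs, twoPow]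
        linear_combination (1 + s) ^ b * s ^ a * l * h3

/-! ### Integrals of weights against the law of the radius -/

/-- The pair `(μ, S)` behaves like the volume of hyperbolic `n`-space together with the hyperbolic
sine of the distance to a point: `S` is distributed as `c t ^ (n - 1) / √(1 + t ^ 2) dt`. -/
structure IsHyperbolicRadius {X : Type*} [MeasurableSpace X] (μ : Measure X) (S : X → ℝ)
    (n : ℝ) (c : ℝ≥0∞) : Prop where
  measurable : Measurable S
  ne_zero : c ≠ 0
  ne_top : c ≠ ⊤
  lintegral_comp : ∀ φ : ℝ → ℝ≥0∞, Measurable φ →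
    ∫⁻ x, φ (S x) ∂μ = c * ∫⁻ t in Ioi (0 : ℝ),
      ENNReal.ofReal (t ^ (n - 1) * (√(1 + t ^ 2))⁻¹) * φ t

variable {X : Type*} [MeasurableSpace X] {μ : Measure X} {S : X → ℝ} {n : ℝ} {c : ℝ≥0∞}

namespace IsHyperbolicRadius

theorem setLIntegral_comp (h : IsHyperbolicRadius μ S n c) {I : Set ℝ} (hI : MeasurableSet I)
    {φ : ℝ → ℝ≥0∞} (hφ : Measurable φ) :
    ∫⁻ x in S ⁻¹' I, φ (S x) ∂μ = c * ∫⁻ t in I ∩ Ioi 0,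
      ENNReal.ofReal (t ^ (n - 1) * (√(1 + t ^ 2))⁻¹) * φ t := by
  rw [← lintegral_indicator (h.measurable hI)]
  have h1 := h.lintegral_comp (I.indicator φ) (hφ.indicator hI)
  have h2 : ∀ t, ENNReal.ofReal (t ^ (n - 1) * (√(1 + t ^ 2))⁻¹) * I.indicator φ t =
      I.indicator (fun t => ENNReal.ofReal (t ^ (n - 1) * (√(1 + t ^ 2))⁻¹) * φ t) t := by
    intro t
    by_cases ht : t ∈ I <;> simp [ht]
  simp only [h2] at h1
  rw [lintegral_indicator hI, Measure.restrict_restrict hI] at h1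
  rw [← h1]
  rfl

theorem ae_pos (h : IsHyperbolicRadius μ S n c) : ∀ᵐ x ∂μ, 0 < S x := by
  have h1 := h.setLIntegral_comp (measurableSet_Iic (a := (0 : ℝ))) (φ := fun _ => 1)
    measurable_const
  have h2 : Iic (0 : ℝ) ∩ Ioi 0 = ∅ := by
    ext t; simp
  rw [h2, Measure.restrict_empty, lintegral_zero_measure, mul_zero, setLIntegral_one] at h1
  rw [ae_iff]
  convert! h1 using 2
  ext x
  simp

theorem density_le {t : ℝ} (ht : 0 < t) :
    t ^ (n - 1) * (√(1 + t ^ 2))⁻¹ ≤ 2 * twoPow (n - 1) (-1) t := by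
  have h1 : (1 + t) / 2 ≤ √(1 + t ^ 2) := by
    apply Real.le_sqrt_of_sq_le
    nlinarith [sq_nonneg (1 - t)]
  have h2 : (√(1 + t ^ 2))⁻¹ ≤ ((1 + t) / 2)⁻¹ := inv_anti₀ (by linarith) h1
  rw [twoPow, Real.rpow_neg_one]
  calc t ^ (n - 1) * (√(1 + t ^ 2))⁻¹ ≤ t ^ (n - 1) * ((1 + t) / 2)⁻¹ := by gcongr
    _ = _ := by rw [inv_div]; ring

theorem density_mul_twoPow_le {e f A b t : ℝ} (ht : 0 < t) (hA : A ≤ e + n)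
    (hb : e + n + f - 1 ≤ A + b) :
    ENNReal.ofReal (t ^ (n - 1) * (√(1 + t ^ 2))⁻¹) * ENNReal.ofReal (twoPow e f t) ≤
      2 * ENNReal.ofReal (twoPow (A - 1) b t) := by
  have h0 : (2 : ℝ≥0∞) = ENNReal.ofReal 2 := by simp
  have h1 := (twoPow_pos (a := e) (b := f) ht).le
  rw [← ENNReal.ofReal_mul (by positivity), h0, ← ENNReal.ofReal_mul (by norm_num)]
  refine ENNReal.ofReal_le_ofReal ?_
  calc _ ≤ 2 * twoPow (n - 1) (-1) t * twoPow e f t :=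
        mul_le_mul_of_nonneg_right (density_le ht) h1
    _ = 2 * twoPow (n - 1 + e) (-1 + f) t := by rw [mul_assoc, twoPow_mul ht]
    _ ≤ _ := by
      gcongr
      exact twoPow_le_twoPow ht (by linarith) (by linarith)

theorem setLIntegral_twoPow_le (h : IsHyperbolicRadius μ S n c) {I : Set ℝ}
    (hI : MeasurableSet I) {e f A b : ℝ} (hA : A ≤ e + n) (hb : e + n + f - 1 ≤ A + b)
    {r : ℝ} (hr : ∫⁻ t in I ∩ Ioi 0, ENNReal.ofReal (twoPow (A - 1) b t) ≤ ENNReal.ofReal r) :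
    ∫⁻ x in S ⁻¹' I, ENNReal.ofReal (twoPow e f (S x)) ∂μ ≤
      ENNReal.ofReal (2 * c.toReal * r) := by
  rw [h.setLIntegral_comp hI (measurable_twoPow e f).ennreal_ofReal,
    ENNReal.ofReal_mul (by positivity), ENNReal.ofReal_mul (by norm_num),
    ENNReal.ofReal_toReal h.ne_top, ENNReal.ofReal_ofNat, mul_comm 2 c, mul_assoc]
  gcongr
  calc _ ≤ ∫⁻ t in I ∩ Ioi 0, 2 * ENNReal.ofReal (twoPow (A - 1) b t) :=
        setLIntegral_mono' (hI.inter measurableSet_Ioi) fun t ht =>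
          density_mul_twoPow_le ht.2 hA hb
    _ ≤ _ := by
        rw [lintegral_const_mul _ (measurable_twoPow _ _).ennreal_ofReal]
        gcongr

/-- The true exponents of the integral are `e + n` at `0` and `e + n + f - 1` at infinity. Allowing
`A` and `A + b` to differ from them in the harmless direction lets the balance conditions enter as
inequalities. -/
theorem exists_lintegral_lt_twoPow_le (h : IsHyperbolicRadius μ S n c) {e f A b : ℝ}
    (hA0 : 0 < A) (hb0 : 0 < A + b) (hA : A ≤ e + n) (hb : e + n + f - 1 ≤ A + b) :
    ∃ C : ℝ, 0 ≤ C ∧ ∀ s, 0 < s → ∫⁻ x in {x | S x < s}, ENNReal.ofReal (twoPow e f (S x)) ∂μ ≤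
      ENNReal.ofReal (C * twoPow A b s) := by
  refine ⟨2 * c.toReal * (1 / A + 1 / (A + b)), by positivity, fun s hs => ?_⟩
  rw [mul_assoc]
  refine h.setLIntegral_twoPow_le (I := Iio s) measurableSet_Iio hA hb ?_
  have hI : Iio s ∩ Ioi 0 = Ioo 0 s := by rw [inter_comm]; rfl
  rw [hI]
  refine lintegral_twoPow_le measurableSet_Ioo (fun t ht => ht.1) hs (by positivity)
    (by positivity) ?_ ?_
  · rw [lintegral_Ioo_rpow hA0 hs, mul_one_div]
  · rw [lintegral_Ioo_rpow hb0 hs, mul_one_div]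

theorem exists_lintegral_gt_twoPow_le (h : IsHyperbolicRadius μ S n c) {e f A b : ℝ}
    (hA0 : A < 0) (hb0 : A + b < 0) (hA : A ≤ e + n) (hb : e + n + f - 1 ≤ A + b) :
    ∃ C : ℝ, 0 ≤ C ∧ ∀ s, 0 < s → ∫⁻ x in {x | s < S x}, ENNReal.ofReal (twoPow e f (S x)) ∂μ ≤
      ENNReal.ofReal (C * twoPow A b s) := by
  have h1 : 0 < -A := by linarith
  have h2 : 0 < -(A + b) := by linarith
  refine ⟨2 * c.toReal * (1 / -A + 1 / -(A + b)), by positivity, fun s hs => ?_⟩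
  rw [mul_assoc]
  refine h.setLIntegral_twoPow_le (I := Ioi s) measurableSet_Ioi hA hb ?_
  have hI : Ioi s ∩ Ioi 0 = Ioi s := inter_eq_left.2 (Ioi_subset_Ioi hs.le)
  rw [hI]
  refine lintegral_twoPow_le measurableSet_Ioi (fun t ht => hs.trans ht) hs (by positivity)
    (by positivity) ?_ ?_
  · rw [lintegral_Ioi_rpow hA0 hs, mul_one_div]
  · rw [lintegral_Ioi_rpow hb0 hs, mul_one_div]

end IsHyperbolicRadius

/-! ### Sufficiency: the Hardy inequality -/

theorem lintegral_setLIntegral_lt_mul [SFinite μ] (hS : Measurable S) {H M : X → ℝ≥0∞}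
    (hH : Measurable H) (hM : Measurable M) :
    ∫⁻ x, (∫⁻ y in {y | S y < S x}, H y ∂μ) * M x ∂μ =
      ∫⁻ y, H y * ∫⁻ x in {x | S y < S x}, M x ∂μ ∂μ := by
  have hms : MeasurableSet {z : X × X | S z.2 < S z.1} :=
    measurableSet_lt (hS.comp measurable_snd) (hS.comp measurable_fst)
  have e1 : ∀ x, (∫⁻ y in {y | S y < S x}, H y ∂μ) * M x =
      ∫⁻ y, {z : X × X | S z.2 < S z.1}.indicator (fun z => H z.2 * M z.1) (x, y) ∂μ := by
    intro x
    rw [← lintegral_mul_const _ hH, ← lintegral_indicator (measurableSet_lt hS measurable_const)]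
    rfl
  have e2 : ∀ y, H y * ∫⁻ x in {x | S y < S x}, M x ∂μ =
      ∫⁻ x, {z : X × X | S z.2 < S z.1}.indicator (fun z => H z.2 * M z.1) (x, y) ∂μ := by
    intro y
    rw [← lintegral_const_mul _ hM, ← lintegral_indicator (measurableSet_lt measurable_const hS)]
    rfl
  simp only [e1, e2]
  refine lintegral_lintegral_swap (Measurable.aemeasurable ?_)
  refine Measurable.indicator ?_ hms
  fun_prop

theorem ofReal_twoPow_rpow {a b r t : ℝ} (ht : 0 < t) :
    ENNReal.ofReal (twoPow a b t) ^ r = ENNReal.ofReal (twoPow (a * r) (b * r) t) := by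
  rw [ENNReal.ofReal_rpow_of_pos (twoPow_pos ht), twoPow_rpow ht]

theorem ofReal_twoPow_mul {a b a' b' t : ℝ} (ht : 0 < t) :
    ENNReal.ofReal (twoPow a b t) * ENNReal.ofReal (twoPow a' b' t) =
      ENNReal.ofReal (twoPow (a + a') (b + b') t) := by
  rw [← ENNReal.ofReal_mul (twoPow_pos ht).le, twoPow_mul ht]

theorem twoPow_zero_zero {t : ℝ} : twoPow 0 0 t = 1 := by simp [twoPow]

namespace IsHyperbolicRadius

/-- Hölder's inequality against a two-power weight. -/
theorem setLIntegral_le_mul_twoPow (h : IsHyperbolicRadius μ S n c) {p p' : ℝ}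
    (hpp : p.HolderConjugate p') {f : X → ℝ≥0∞} (hf : Measurable f) (B : Set X) (e b : ℝ) :
    ∫⁻ y in B, f y ∂μ ≤
      (∫⁻ y in B, f y ^ p * ENNReal.ofReal (twoPow (p * e) (p * b) (S y)) ∂μ) ^ (1 / p) *
        (∫⁻ y in B, ENNReal.ofReal (twoPow (-(p' * e)) (-(p' * b)) (S y)) ∂μ) ^ (1 / p') := by
  have hw : ∀ e b, Measurable fun y => ENNReal.ofReal (twoPow e b (S y)) := fun e b =>
    ((measurable_twoPow e b).comp h.measurable).ennreal_ofReal
  have hpos : ∀ᵐ y ∂μ.restrict B, 0 < S y := ae_restrict_of_ae h.ae_pos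
  have hH := ENNReal.lintegral_mul_le_Lp_mul_Lq (μ.restrict B) hpp
    (f := fun y => f y * ENNReal.ofReal (twoPow e b (S y)))
    (g := fun y => ENNReal.ofReal (twoPow (-e) (-b) (S y)))
    (hf.mul (hw e b)).aemeasurable (hw _ _).aemeasurable
  have e1 : ∫⁻ y in B, f y ∂μ = ∫⁻ y in B, ((fun y => f y * ENNReal.ofReal (twoPow e b (S y))) *
      fun y => ENNReal.ofReal (twoPow (-e) (-b) (S y))) y ∂μ := by
    refine lintegral_congr_ae (hpos.mono fun y hy => ?_)
    simp only [Pi.mul_apply]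
    rw [mul_assoc, ofReal_twoPow_mul hy, add_neg_cancel, add_neg_cancel, twoPow_zero_zero,
      ENNReal.ofReal_one, mul_one]
  have e2 : ∫⁻ y in B, f y ^ p * ENNReal.ofReal (twoPow (p * e) (p * b) (S y)) ∂μ =
      ∫⁻ y in B, (f y * ENNReal.ofReal (twoPow e b (S y))) ^ p ∂μ := by
    refine lintegral_congr_ae (hpos.mono fun y hy => ?_)
    simp only
    rw [ENNReal.mul_rpow_of_nonneg _ _ hpp.nonneg, ofReal_twoPow_rpow hy, mul_comm e, mul_comm b]
  have e3 : ∫⁻ y in B, ENNReal.ofReal (twoPow (-(p' * e)) (-(p' * b)) (S y)) ∂μ =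
      ∫⁻ y in B, ENNReal.ofReal (twoPow (-e) (-b) (S y)) ^ p' ∂μ := by
    refine lintegral_congr_ae (hpos.mono fun y hy => ?_)
    simp only
    rw [ofReal_twoPow_rpow hy]
    congr 2 <;> ring
  rw [e1, e2, e3]
  exact hH

/-- If the power weights are in balance, the Hardy operator is bounded. -/
theorem exists_hardy_le [SFinite μ] (h : IsHyperbolicRadius μ S n c) {p p' q α β : ℝ}
    (hpp : p.HolderConjugate p') (hpq : p ≤ q)
    (hα : α + n < 1) (hβ : 0 < β * (1 - p') + n)
    (h0 : 0 ≤ (α + n) / q + (β * (1 - p') + n) / p')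
    (h1 : (α + n) / q + (β * (1 - p') + n) / p' ≤ 1 / q + 1 / p') :
    ∃ C : ℝ, 0 ≤ C ∧ ∀ f : X → ℝ≥0∞, Measurable f →
      (∫⁻ x, (∫⁻ y in {y | S y < S x}, f y ∂μ) ^ q * ENNReal.ofReal (S x ^ α) ∂μ) ≤
        ENNReal.ofReal C * (∫⁻ x, f x ^ p * ENNReal.ofReal (S x ^ β) ∂μ) ^ (q / p) := by
  have hp := hpp.pos
  have hp' := hpp.symm.pos
  have hq : 0 < q := by linarith
  set x := α + n with hx
  set γ := β * (1 - p') + n with hγ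
  have hconj : p' * (β / p) = -(β * (1 - p')) := by
    have := hpp.symm.sub_one_mul_conj
    field_simp
    linear_combination -β * this
  have h0' : 0 ≤ x + γ * q / p' := by
    have := mul_nonneg hq.le h0
    have e : q * (x / q + γ / p') = x + γ * q / p' := by field_simp
    linarith
  have h1' : γ - 1 ≤ (1 - x) * p' / q := by
    have := mul_le_mul_of_nonneg_left h1 hp'.le
    have e : p' * (x / q + γ / p') = x * p' / q + γ := by field_simp
    have e' : p' * (1 / q + 1 / p') = p' / q + 1 := by field_simp
    have e'' : (1 - x) * p' / q = p' / q - x * p' / q := by ring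
    linarith
  -- The Hölder weight has exponent `β / p + a` at `0` and `β / p + d` at infinity. Here `a` spends
  -- half of the room in `0 < γ`, and `d` half of that in `x < 1`; `A` and `B` are the end exponents
  -- of the bound for the dual integral.
  obtain ⟨a, ha⟩ : ∃ a, a = γ / (2 * p') := ⟨_, rfl⟩
  obtain ⟨d, hd⟩ : ∃ d, d = (1 - x) / (2 * q) := ⟨_, rfl⟩
  obtain ⟨A, hA⟩ : ∃ A, A = γ / 2 := ⟨_, rfl⟩
  obtain ⟨B, hB⟩ : ∃ B, B = (1 - x) * p' / (2 * q) := ⟨_, rfl⟩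
  have hx1 : 0 < 1 - x := by linarith
  have ha0 : 0 < a := by rw [ha]; positivity
  have hd0 : 0 < d := by rw [hd]; positivity
  have hA0 : 0 < A := by rw [hA]; positivity
  have hB0 : 0 < B := by rw [hB]; positivity
  have hpa : p' * a = γ / 2 := by rw [ha]; field_simp
  have hpd : p' * d = B := by rw [hd, hB]; field_simp
  have hqa : a * q + A * (q / p') = γ * q / p' := by rw [ha, hA]; field_simp; ring
  have hqd : d * q + B * (q / p') = 1 - x := by rw [hd, hB]; field_simp; ring
  have hBB : (1 - x) * p' / q = 2 * B := by rw [hB]; field_simp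
  -- For the dual weight the exponent at `0` is exactly `A`; at infinity it is `γ - B - 1`, at most
  -- `B` by the upper balance condition.
  obtain ⟨C₁, hC₁, hI⟩ := h.exists_lintegral_lt_twoPow_le (A := A) (b := B - A)
    (e := -(p' * (β / p + a))) (f := -(p' * (d - a))) hA0 (by linarith)
    (by rw [mul_add, hconj, hpa]; linarith)
    (by rw [mul_add, hconj, mul_sub p', hpd]; linarith)
  -- The tail must be bounded by the inverse of the factor `twoPow (p * a) (p * (d - a))` to cancel
  -- it after Tonelli. At infinity the exponents agree exactly; at `0` the lower balance condition
  -- suffices.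
  obtain ⟨C₂, hC₂, hJ⟩ := h.exists_lintegral_gt_twoPow_le (A := -(p * a)) (b := -(p * (d - a)))
    (e := p * a * (q / p - 1) + A * (q / p') + α)
    (f := p * (d - a) * (q / p - 1) + (B - A) * (q / p') + 0)
    (by have := mul_pos hp ha0; linarith) (by have := mul_pos hp hd0; linarith)
    (by
      have e : p * a * (q / p - 1) = a * q - p * a := by field_simp
      rw [e]; linarith)
    (by
      have e : p * a * (q / p - 1) = a * q - p * a := by field_simp
      have e' : p * (d - a) * (q / p - 1) = (d - a) * q - p * (d - a) := by field_simp
      rw [e, e']; linarith)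
  have hqp : 0 ≤ q / p - 1 := by
    have := (one_le_div hp).2 hpq
    linarith
  refine ⟨2 ^ (q / p - 1) * C₁ ^ (q / p') * C₂, by positivity, fun f hf => ?_⟩
  have hw : ∀ e b, Measurable fun y => ENNReal.ofReal (twoPow e b (S y)) := fun e b =>
    ((measurable_twoPow e b).comp h.measurable).ennreal_ofReal
  set N := ∫⁻ x, f x ^ p * ENNReal.ofReal (S x ^ β) ∂μ with hN
  set H : X → ℝ≥0∞ := fun y =>
    f y ^ p * ENNReal.ofReal (twoPow (p * (β / p + a)) (p * (d - a)) (S y)) with hH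
  have hHm : Measurable H := (hf.pow_const p).mul (hw _ _)
  have hHeq : ∀ y, 0 < S y → H y = f y ^ p * ENNReal.ofReal (S y ^ β) *
      ENNReal.ofReal (twoPow (p * a) (p * (d - a)) (S y)) := by
    intro y hy
    have e : p * (β / p + a) = β + p * a := by field_simp
    rw [hH, ← twoPow_zero_right, mul_assoc, ofReal_twoPow_mul hy, zero_add]
    simp only [e]
  have hΦ : ∀ x, 0 < S x → ∫⁻ y in {y | S y < S x}, H y ∂μ ≤
      N * ENNReal.ofReal (2 * twoPow (p * a) (p * (d - a)) (S x)) := by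
    intro x hx
    rw [hN, ← lintegral_mul_const'' _ (by have := h.measurable; fun_prop)]
    refine (setLIntegral_mono_ae' (measurableSet_lt h.measurable measurable_const)
      (h.ae_pos.mono fun y hy hyx => ?_)).trans (setLIntegral_le_lintegral {y | S y < S x} _)
    rw [hHeq y hy]
    gcongr
    exact twoPow_le_two_mul hy hyx.le (by positivity)
      (by rw [← mul_add, add_sub_cancel]; positivity)
  set M : X → ℝ≥0∞ := fun x => ENNReal.ofReal (twoPow (p * a * (q / p - 1) + A * (q / p') + α)
    (p * (d - a) * (q / p - 1) + (B - A) * (q / p') + 0) (S x)) with hM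
  set K : ℝ≥0∞ := ENNReal.ofReal (2 ^ (q / p - 1) * C₁ ^ (q / p')) with hK
  have hpt : ∀ x, 0 < S x →
      (∫⁻ y in {y | S y < S x}, f y ∂μ) ^ q * ENNReal.ofReal (S x ^ α) ≤
        N ^ (q / p - 1) * K * ((∫⁻ y in {y | S y < S x}, H y ∂μ) * M x) := by
    intro x hx
    have h2 := h.setLIntegral_le_mul_twoPow hpp hf {y | S y < S x} (β / p + a) (d - a)
    have h3 := ENNReal.rpow_le_rpow h2 hq.le
    rw [ENNReal.mul_rpow_of_nonneg _ _ hq.le, ← ENNReal.rpow_mul, ← ENNReal.rpow_mul,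
      one_div_mul_eq_div, one_div_mul_eq_div] at h3
    -- Keep one power of the integral of `H` for Tonelli and bound the other `q / p - 1 ≥ 0` powers
    -- through `N`.
    have h4 : (∫⁻ y in {y | S y < S x}, H y ∂μ) ^ (q / p) ≤ (∫⁻ y in {y | S y < S x}, H y ∂μ) *
        (N ^ (q / p - 1) * ENNReal.ofReal (2 ^ (q / p - 1) *
          twoPow (p * a * (q / p - 1)) (p * (d - a) * (q / p - 1)) (S x))) := by
      calc (∫⁻ y in {y | S y < S x}, H y ∂μ) ^ (q / p)
          = (∫⁻ y in {y | S y < S x}, H y ∂μ) *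
              (∫⁻ y in {y | S y < S x}, H y ∂μ) ^ (q / p - 1) := by
            conv_rhs => enter [1]; rw [← ENNReal.rpow_one (∫⁻ y in {y | S y < S x}, H y ∂μ)]
            rw [← ENNReal.rpow_add_of_nonneg _ _ zero_le_one hqp, add_sub_cancel]
        _ ≤ _ := by
            gcongr
            refine (ENNReal.rpow_le_rpow (hΦ x hx) hqp).trans_eq ?_
            have := twoPow_pos (a := p * a) (b := p * (d - a)) hx
            rw [ENNReal.mul_rpow_of_nonneg _ _ hqp, ENNReal.ofReal_rpow_of_pos (by positivity),
              Real.mul_rpow (by norm_num) this.le, twoPow_rpow hx]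
    have h5 : (∫⁻ y in {y | S y < S x},
        ENNReal.ofReal (twoPow (-(p' * (β / p + a))) (-(p' * (d - a))) (S y)) ∂μ) ^ (q / p') ≤
          ENNReal.ofReal (C₁ ^ (q / p') * twoPow (A * (q / p')) ((B - A) * (q / p')) (S x)) := by
      refine (ENNReal.rpow_le_rpow (hI _ hx) (by positivity)).trans_eq ?_
      have := twoPow_pos (a := A) (b := B - A) hx
      rw [ENNReal.ofReal_rpow_of_nonneg (by positivity) (by positivity),
        Real.mul_rpow hC₁ this.le, twoPow_rpow hx]
    refine (mul_le_mul' (h3.trans (mul_le_mul' h4 h5)) le_rfl).trans_eq ?_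
    rw [hM, hK]
    simp only
    rw [← ofReal_twoPow_mul hx, ← ofReal_twoPow_mul hx, twoPow_zero_right,
      ENNReal.ofReal_mul (by positivity), ENNReal.ofReal_mul (by positivity),
      ENNReal.ofReal_mul (by positivity)]
    ring
  calc (∫⁻ x, (∫⁻ y in {y | S y < S x}, f y ∂μ) ^ q * ENNReal.ofReal (S x ^ α) ∂μ)
      ≤ ∫⁻ x, N ^ (q / p - 1) * K * ((∫⁻ y in {y | S y < S x}, H y ∂μ) * M x) ∂μ :=
        lintegral_mono_ae (h.ae_pos.mono hpt)
    _ = N ^ (q / p - 1) * K * ∫⁻ y, H y * ∫⁻ x in {x | S y < S x}, M x ∂μ ∂μ := by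
        rw [← lintegral_setLIntegral_lt_mul h.measurable hHm (hw _ _)]
        refine lintegral_const_mul'' _ (Measurable.aemeasurable ?_)
        refine Measurable.mul ?_ (hw _ _)
        -- The inner integral is a monotone function of the radius, hence measurable.
        have hg : Monotone fun s : ℝ => ∫⁻ y in {y | S y < s}, H y ∂μ := fun s t hst =>
          lintegral_mono_set fun y hy => lt_of_lt_of_le hy hst
        exact hg.measurable.comp h.measurable
    _ ≤ N ^ (q / p - 1) * K *
        ∫⁻ y, ENNReal.ofReal C₂ * (f y ^ p * ENNReal.ofReal (S y ^ β)) ∂μ := by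
        gcongr 1
        refine lintegral_mono_ae (h.ae_pos.mono fun y hy => ?_)
        rw [hHeq y hy]
        refine (mul_le_mul' le_rfl (hJ _ hy)).trans_eq ?_
        rw [ENNReal.ofReal_mul hC₂]
        calc _ = ENNReal.ofReal C₂ * (f y ^ p * ENNReal.ofReal (S y ^ β)) *
              (ENNReal.ofReal (twoPow (p * a) (p * (d - a)) (S y)) *
                ENNReal.ofReal (twoPow (-(p * a)) (-(p * (d - a))) (S y))) := by ring
          _ = _ := by
            rw [ofReal_twoPow_mul hy, add_neg_cancel, add_neg_cancel, twoPow_zero_zero,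
              ENNReal.ofReal_one, mul_one]
    _ = ENNReal.ofReal (2 ^ (q / p - 1) * C₁ ^ (q / p') * C₂) * N ^ (q / p) := by
        rw [lintegral_const_mul' _ _ ENNReal.ofReal_ne_top, ← hN,
          ENNReal.ofReal_mul (p := 2 ^ (q / p - 1) * C₁ ^ (q / p')) (by positivity), ← hK]
        have : N ^ (q / p) = N ^ (q / p - 1) * N := by
          conv_rhs => enter [2]; rw [← ENNReal.rpow_one N]
          rw [← ENNReal.rpow_add_of_nonneg _ _ hqp zero_le_one, sub_add_cancel]
        rw [this]
        ring

end IsHyperbolicRadius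

/-! ### Necessity: testing on annuli -/

/-- The mass that `t ^ (e - 1) / √(1 + t ^ 2) dt` gives to `I`. -/
noncomputable def powMass (e : ℝ) (I : Set ℝ) : ℝ≥0∞ :=
  ∫⁻ t in I, ENNReal.ofReal (t ^ (e - 1) * (√(1 + t ^ 2))⁻¹)

theorem sqrt_one_add_sq_le {t : ℝ} (ht : 0 ≤ t) : √(1 + t ^ 2) ≤ 1 + t :=
  Real.sqrt_le_iff.2 ⟨by linarith, by nlinarith⟩

theorem exists_twoPow_le_powMass (e : ℝ) :
    ∃ k : ℝ, 0 < k ∧ ∀ l, 0 < l →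
      ENNReal.ofReal (k * twoPow e (-1) l) ≤ powMass e (Ioo l (2 * l)) := by
  -- The minimum covers both signs of `e - 1` on `(l, 2 * l)`; the `2` comes from `√(1 + t ^ 2) ≤ 2
  -- * (1 + l)` there.
  refine ⟨min 1 (2 ^ (e - 1)) / 2, by positivity, fun l hl => ?_⟩
  have hle : ∀ t ∈ Ioo l (2 * l), min 1 (2 ^ (e - 1)) / 2 * twoPow (e - 1) (-1) l ≤
      t ^ (e - 1) * (√(1 + t ^ 2))⁻¹ := by
    intro t ⟨h1, h2⟩
    have ht : 0 < t := hl.trans h1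
    have h3 : min 1 (2 ^ (e - 1)) * l ^ (e - 1) ≤ t ^ (e - 1) := by
      rcases le_total 0 (e - 1) with he | he
      · calc _ ≤ 1 * l ^ (e - 1) := by gcongr; exact min_le_left _ _
          _ ≤ t ^ (e - 1) := by rw [one_mul]; gcongr
      · calc _ ≤ 2 ^ (e - 1) * l ^ (e - 1) := by gcongr; exact min_le_right _ _
          _ = (2 * l) ^ (e - 1) := by rw [Real.mul_rpow (by norm_num) hl.le]
          _ ≤ t ^ (e - 1) := Real.rpow_le_rpow_of_nonpos ht h2.le he
    have h4 : (2 * (1 + l))⁻¹ ≤ (√(1 + t ^ 2))⁻¹ := by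
      apply inv_anti₀ (by positivity)
      linarith [sqrt_one_add_sq_le ht.le]
    calc _ = min 1 (2 ^ (e - 1)) * l ^ (e - 1) * (2 * (1 + l))⁻¹ := by
          rw [twoPow, Real.rpow_neg_one, mul_inv]; ring
      _ ≤ _ := by gcongr
  calc ENNReal.ofReal (min 1 (2 ^ (e - 1)) / 2 * twoPow e (-1) l)
      = ∫⁻ _ in Ioo l (2 * l),
          ENNReal.ofReal (min 1 (2 ^ (e - 1)) / 2 * twoPow (e - 1) (-1) l) := by
        have := twoPow_pos (a := e - 1) (b := -1) hl
        rw [setLIntegral_const, Real.volume_Ioo, ← ENNReal.ofReal_mul (by positivity)]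
        congr 1
        rw [twoPow, twoPow, Real.rpow_sub_one hl.ne']
        field_simp
        ring
    _ ≤ _ := setLIntegral_mono' measurableSet_Ioo fun t ht =>
        ENNReal.ofReal_le_ofReal (hle t ht)

theorem log_le_powMass {e l m : ℝ} (hl : 0 < l) (hlm : l ≤ m)
    (h : ∀ t ∈ Ioo l m, t⁻¹ / 2 ≤ t ^ (e - 1) * (√(1 + t ^ 2))⁻¹) :
    ENNReal.ofReal (Real.log (m / l) / 2) ≤ powMass e (Ioo l m) := by
  have hc : IntegrableOn (fun t : ℝ => t⁻¹ / 2) (Icc l m) :=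
    ContinuousOn.integrableOn_Icc fun t ht =>
      ((continuousAt_inv₀ (hl.trans_le ht.1).ne').div_const 2).continuousWithinAt
  have hI : ∫ t in Ioo l m, t⁻¹ / 2 = Real.log (m / l) / 2 := by
    rw [← integral_Ioc_eq_integral_Ioo, ← intervalIntegral.integral_of_le hlm,
      intervalIntegral.integral_div, integral_inv_of_pos hl (hl.trans_le hlm)]
  rw [← hI, ofReal_integral_eq_lintegral_ofReal (hc.mono_set Ioo_subset_Icc_self)]
  · exact setLIntegral_mono' measurableSet_Ioo fun t ht => ENNReal.ofReal_le_ofReal (h t ht)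
  · filter_upwards [ae_restrict_mem measurableSet_Ioo] with t ht
    have := hl.trans ht.1
    simp only [Pi.zero_apply]
    positivity

theorem powMass_Ioo_ne_top {e l m : ℝ} (hl : 0 < l) : powMass e (Ioo l m) ≠ ⊤ := by
  have hc : IntegrableOn (fun t : ℝ => t ^ (e - 1) * (√(1 + t ^ 2))⁻¹) (Icc l m) := by
    refine ContinuousOn.integrableOn_Icc fun t ht => ?_
    have ht : 0 < t := hl.trans_le ht.1
    refine ContinuousAt.continuousWithinAt (ContinuousAt.mul ?_ ?_)
    · exact Real.continuousAt_rpow_const _ _ (Or.inl ht.ne')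
    · exact ContinuousAt.inv₀ (by fun_prop) (by positivity)
  exact (hc.mono_set Ioo_subset_Icc_self).lintegral_lt_top.ne

theorem exists_lt_mul_rpow {k s w : ℝ} (C : ℝ) (hk : 0 < k) (hs : 0 < s) (hw : 0 < w) :
    ∃ L, 0 < L ∧ C < (k * L) ^ s * w := by
  have h : 0 < (|C| + 1) / w := by positivity
  refine ⟨((|C| + 1) / w) ^ s⁻¹ / k, by positivity, ?_⟩
  rw [mul_div_cancel₀ _ hk.ne', ← Real.rpow_mul h.le, inv_mul_cancel₀ hs.ne', Real.rpow_one,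
    div_mul_cancel₀ _ hw.ne']
  linarith [le_abs_self C]

theorem nonpos_of_forall_rpow_le {δ K : ℝ} (h : ∀ r : ℝ, 1 ≤ r → r ^ δ ≤ K) : δ ≤ 0 := by
  by_contra! hδ
  obtain ⟨r, h1, h2⟩ := (((tendsto_rpow_atTop hδ).eventually_gt_atTop K).and
    (Filter.eventually_ge_atTop 1)).exists
  exact absurd (h r h2) (not_le.2 h1)

/-- Boundedness as `r → 0`, where the weight is like `r ^ θ`, gives the first inequality; as `r →
∞`, where it is like `r ^ (θ - τ)`, the second. -/
theorem of_forall_twoPow_le {θ τ K : ℝ} (hτ : 0 ≤ τ)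
    (h : ∀ r : ℝ, 0 < r → twoPow θ (-τ) r ≤ K) : 0 ≤ θ ∧ θ ≤ τ := by
  have h2 : ∀ r : ℝ, 0 < r → r ≤ 1 → r ^ θ ≤ 2 ^ τ * K := by
    intro r hr hr1
    have h3 := h r hr
    have h4 : (2 : ℝ) ^ (-τ) ≤ (1 + r) ^ (-τ) :=
      Real.rpow_le_rpow_of_nonpos (by linarith) (by linarith) (by linarith)
    have h5 : r ^ θ * 2 ^ (-τ) ≤ K := le_trans (by unfold twoPow; gcongr) h3
    rw [Real.rpow_neg (by norm_num), ← div_eq_mul_inv, div_le_iff₀ (by positivity)] at h5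
    linarith
  have h3 : ∀ r : ℝ, 1 ≤ r → r ^ (θ - τ) ≤ 2 ^ τ * K := by
    intro r hr
    have hr0 : 0 < r := by linarith
    have h3 := h r hr0
    have h4 : (2 * r) ^ (-τ) ≤ (1 + r) ^ (-τ) :=
      Real.rpow_le_rpow_of_nonpos (by linarith) (by linarith) (by linarith)
    have h5 : r ^ θ * (2 * r) ^ (-τ) ≤ K := le_trans (by unfold twoPow; gcongr) h3
    rw [Real.rpow_neg (by positivity), ← div_eq_mul_inv, div_le_iff₀ (by positivity),
      Real.mul_rpow (by norm_num) hr0.le] at h5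
    rw [Real.rpow_sub hr0, div_le_iff₀ (by positivity)]
    linarith
  constructor
  · have := nonpos_of_forall_rpow_le (δ := -θ) (K := 2 ^ τ * K) fun r hr => by
      have hr0 : 0 < r := by linarith
      have := h2 r⁻¹ (by positivity) (inv_le_one_of_one_le₀ hr)
      rwa [Real.inv_rpow hr0.le, ← Real.rpow_neg hr0.le] at this
    linarith
  · linarith [nonpos_of_forall_rpow_le h3]

/-- The exponent conditions follow from a Muckenhoupt-type bound on dyadic annuli. -/
theorem conditions_of_powMass_le {c : ℝ≥0∞} (hc0 : c ≠ 0) (hc : c ≠ ⊤) {x γ q p' C : ℝ}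
    (hq : 0 < q) (hp' : 0 < p') (hC : 0 ≤ C)
    (h : ∀ l r R : ℝ, 0 < l → l < r → r < R →
      (c * powMass x (Ioo r R)) ^ (1 / q) * (c * powMass γ (Ioo l r)) ^ (1 / p') ≤
        ENNReal.ofReal C) :
    x < 1 ∧ 0 < γ ∧ 0 ≤ x / q + γ / p' ∧ x / q + γ / p' ≤ 1 / q + 1 / p' := by
  obtain ⟨k, hk, hkc⟩ : ∃ k : ℝ, 0 < k ∧ ENNReal.ofReal k = c :=
    ⟨c.toReal, ENNReal.toReal_pos hc0 hc, ENNReal.ofReal_toReal hc⟩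
  have key : ∀ l r R u v : ℝ, 0 < l → l < r → r < R → 0 ≤ u → 0 ≤ v →
      ENNReal.ofReal u ≤ powMass x (Ioo r R) → ENNReal.ofReal v ≤ powMass γ (Ioo l r) →
      (k * u) ^ (1 / q) * (k * v) ^ (1 / p') ≤ C := by
    intro l r R u v hl hlr hrR hu hv hu' hv'
    rw [← ENNReal.ofReal_le_ofReal_iff hC, ENNReal.ofReal_mul (by positivity),
      ← ENNReal.ofReal_rpow_of_nonneg (by positivity) (by positivity),
      ← ENNReal.ofReal_rpow_of_nonneg (by positivity) (by positivity),
      ENNReal.ofReal_mul hk.le, ENNReal.ofReal_mul hk.le, hkc]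
    refine le_trans ?_ (h l r R hl hlr hrR)
    gcongr
  obtain ⟨kx, hkx, hx⟩ := exists_twoPow_le_powMass x
  obtain ⟨kγ, hkγ, hγ⟩ := exists_twoPow_le_powMass γ
  have hP : ∀ (e : ℝ) {l : ℝ}, 0 < l → 0 < twoPow e (-1) l := fun e l hl => twoPow_pos hl
  refine ⟨?_, ?_, of_forall_twoPow_le (K := C / ((k * (kx * (2 ^ x / 2))) ^ (1 / q) *
    (k * kγ) ^ (1 / p'))) (by positivity) fun r hr => ?_⟩
  -- With the inner annulus `(1 / 2, 1)` fixed, the outer mass on `(1, exp L)` is at least `L / 2`,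
  -- which is unbounded.
  · by_contra! hx1
    have hw := hP γ (l := 1 / 2) (by norm_num)
    obtain ⟨L, hL, hLC⟩ := exists_lt_mul_rpow (k := k / 2) (s := 1 / q)
      (w := (k * (kγ * twoPow γ (-1) (1 / 2))) ^ (1 / p')) C (by positivity) (by positivity)
      (by positivity)
    refine absurd (key (1 / 2) 1 (Real.exp L) (L / 2) _ (by norm_num) (by norm_num)
      (Real.one_lt_exp_iff.2 hL) (by positivity) (by positivity) ?_
      ((hγ (1 / 2) (by norm_num)).trans_eq (by norm_num))) (not_le.2 ?_)
    · have := log_le_powMass (e := x) one_pos (Real.one_lt_exp_iff.2 hL).le fun t ht => ?_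
      · simpa using this
      · have h1 : 1 < t := ht.1
        have h2 : 1 ≤ t ^ (x - 1) := Real.one_le_rpow h1.le (by linarith)
        have h3 : (2 * t)⁻¹ ≤ (√(1 + t ^ 2))⁻¹ := by
          apply inv_anti₀ (by positivity)
          linarith [sqrt_one_add_sq_le (t := t) (by linarith)]
        calc t⁻¹ / 2 = 1 * (2 * t)⁻¹ := by rw [mul_inv]; ring
          _ ≤ _ := by gcongr
    · rwa [mul_div_assoc', ← div_mul_eq_mul_div]
  -- Symmetrically, fix the outer annulus `(1, 2)` and let the inner one `(exp (-L), 1)` reach down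
  -- to `0`.
  · by_contra! hγ0
    have hw := hP x (l := 1) (by norm_num)
    obtain ⟨L, hL, hLC⟩ := exists_lt_mul_rpow (k := k / 2) (s := 1 / p')
      (w := (k * (kx * twoPow x (-1) 1)) ^ (1 / q)) C (by positivity) (by positivity)
      (by positivity)
    have hlt : Real.exp (-L) < 1 := Real.exp_zero ▸ Real.exp_lt_exp.2 (by linarith)
    refine absurd (key (Real.exp (-L)) 1 2 _ (L / 2) (Real.exp_pos _) hlt
      (by norm_num) (by positivity) (by positivity) ((hx 1 one_pos).trans_eq (by norm_num)) ?_)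
      (not_le.2 ?_)
    · have := log_le_powMass (e := γ) (Real.exp_pos (-L)) hlt.le fun t ht => ?_
      · simpa using this
      · have h1 : t < 1 := ht.2
        have h0 : 0 < t := (Real.exp_pos _).trans ht.1
        have h2 : t⁻¹ ≤ t ^ (γ - 1) := by
          rw [← Real.rpow_neg_one]
          exact Real.rpow_le_rpow_of_exponent_ge h0 h1.le (by linarith)
        have h3 : (2 : ℝ)⁻¹ ≤ (√(1 + t ^ 2))⁻¹ := by
          apply inv_anti₀ (by positivity)
          linarith [sqrt_one_add_sq_le h0.le]
        rw [div_eq_mul_inv]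
        gcongr
    · rwa [mul_comm, mul_div_assoc', ← div_mul_eq_mul_div]
  -- Test on the annuli `(r, 2 * r)` and `(2 * r, 4 * r)`; the factor `2 ^ x / 2` is the price of
  -- evaluating the outer weight at `r` rather than `2 * r`.
  · have hr2 : 0 < 2 * r := by linarith
    have h1 := hP x hr
    have h2 := hP γ hr
    have h3 : kx * (2 ^ x / 2) * twoPow x (-1) r ≤ kx * twoPow x (-1) (2 * r) := by
      rw [mul_assoc]
      gcongr
      rw [twoPow, twoPow, Real.mul_rpow (by norm_num) hr.le, Real.rpow_neg_one, Real.rpow_neg_one]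
      have : (2 * (1 + r))⁻¹ ≤ (1 + 2 * r)⁻¹ := inv_anti₀ (by positivity) (by linarith)
      calc _ = 2 ^ x * r ^ x * (2 * (1 + r))⁻¹ := by rw [mul_inv]; ring
        _ ≤ _ := by gcongr
    have h4 := key r (2 * r) (2 * (2 * r)) _ _ hr (by linarith) (by linarith) (by positivity)
      (by positivity) ((ENNReal.ofReal_le_ofReal h3).trans (hx (2 * r) hr2)) (hγ r hr)
    rw [le_div_iff₀ (by positivity)]
    refine le_trans (le_of_eq ?_) h4
    rw [← mul_assoc k (_ * _), ← mul_assoc k kγ, Real.mul_rpow (by positivity) h1.le,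
      Real.mul_rpow (by positivity) h2.le, twoPow_rpow hr, twoPow_rpow hr]
    have : twoPow (x / q + γ / p') (-(1 / q + 1 / p')) r =
        twoPow (x * (1 / q)) (-1 * (1 / q)) r * twoPow (γ * (1 / p')) (-1 * (1 / p')) r := by
      rw [twoPow_mul hr]
      congr 1 <;> ring
    rw [this]
    ring

namespace IsHyperbolicRadius

theorem setLIntegral_rpow (h : IsHyperbolicRadius μ S n c) {l r e : ℝ} (hl : 0 < l) :
    ∫⁻ x in S ⁻¹' (Ioo l r), ENNReal.ofReal (S x ^ e) ∂μ = c * powMass (e + n) (Ioo l r) := by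
  have hI : Ioo l r ∩ Ioi 0 = Ioo l r := inter_eq_left.2 fun t ht => hl.trans ht.1
  rw [h.setLIntegral_comp measurableSet_Ioo (φ := fun t => ENNReal.ofReal (t ^ e)) (by fun_prop),
    hI, powMass]
  congr 1
  refine setLIntegral_congr_fun measurableSet_Ioo fun t ht => ?_
  have ht : 0 < t := hl.trans ht.1
  rw [← ENNReal.ofReal_mul (by positivity), mul_right_comm, ← Real.rpow_add ht]
  congr 3
  ring

theorem powMass_le_of_hardy_le (h : IsHyperbolicRadius μ S n c) {p p' q α β C : ℝ}
    (hpp : p.HolderConjugate p') (hq : 0 < q)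
    (hC : ∀ f : X → ℂ, Measurable f →
      (∫⁻ x, (∫⁻ y in {y | S y < S x}, ‖f y‖ₑ ∂μ) ^ q * ENNReal.ofReal (S x ^ α) ∂μ) ^ (1 / q) ≤
        ENNReal.ofReal C * (∫⁻ x, ‖f x‖ₑ ^ p * ENNReal.ofReal (S x ^ β) ∂μ) ^ (1 / p))
    {l r R : ℝ} (hl : 0 < l) (hlr : l < r) :
    (c * powMass (α + n) (Ioo r R)) ^ (1 / q) *
      (c * powMass (β * (1 - p') + n) (Ioo l r)) ^ (1 / p') ≤ ENNReal.ofReal C := by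
  have hr := hl.trans hlr
  have hp := hpp.pos
  have hp' := hpp.symm.pos
  rw [← h.setLIntegral_rpow hr, ← h.setLIntegral_rpow hl]
  have hmA : MeasurableSet (S ⁻¹' Ioo l r) := h.measurable measurableSet_Ioo
  have hmR : MeasurableSet (S ⁻¹' Ioo r R) := h.measurable measurableSet_Ioo
  set V := ∫⁻ x in S ⁻¹' (Ioo l r), ENNReal.ofReal (S x ^ (β * (1 - p'))) ∂μ with hV
  set U := ∫⁻ x in S ⁻¹' (Ioo r R), ENNReal.ofReal (S x ^ α) ∂μ with hU
  have hVtop : V ≠ ⊤ := by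
    rw [hV, h.setLIntegral_rpow hl]
    exact ENNReal.mul_ne_top h.ne_top (powMass_Ioo_ne_top hl)
  rcases eq_or_ne V 0 with hV0 | hV0
  · rw [hV0, ENNReal.zero_rpow_of_pos (by positivity), mul_zero]
    exact zero_le
  -- This is the equality case of Hölder: on the annulus `f ^ p * S ^ β = f`, so both sides are
  -- expressed through the same `V`, and cancelling `V ^ (1 / p)` leaves `V ^ (1 / p')`.
  set f : X → ℂ := (S ⁻¹' Ioo l r).indicator fun x => ((S x ^ (β * (1 - p')) : ℝ) : ℂ) with hf
  have hfm : Measurable f := by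
    refine Measurable.indicator ?_ hmA
    have := h.measurable
    fun_prop
  have hfe : ∀ x, ‖f x‖ₑ =
      (S ⁻¹' Ioo l r).indicator (fun x => ENNReal.ofReal (S x ^ (β * (1 - p')))) x := by
    intro x
    rw [hf, enorm_indicator_eq_indicator_enorm]
    refine congrFun (indicator_congr fun x hx => ?_) x
    have : 0 < S x := hl.trans hx.1
    rw [← ofReal_norm, Complex.norm_real, Real.norm_of_nonneg (by positivity)]
  have hR : ∫⁻ x, ‖f x‖ₑ ^ p * ENNReal.ofReal (S x ^ β) ∂μ = V := by
    rw [hV, ← lintegral_indicator hmA]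
    refine lintegral_congr fun x => ?_
    rw [hfe]
    by_cases hx : x ∈ S ⁻¹' Ioo l r
    · have hS : 0 < S x := hl.trans hx.1
      rw [indicator_of_mem hx, ENNReal.ofReal_rpow_of_pos (by positivity),
        ← ENNReal.ofReal_mul (by positivity), ← Real.rpow_mul hS.le, ← Real.rpow_add hS]
      congr 2
      linear_combination -β * hpp.mul_eq_add
    · rw [indicator_of_notMem hx, ENNReal.zero_rpow_of_pos hp, zero_mul]
  have hL : V ^ q * U ≤
      ∫⁻ x, (∫⁻ y in {y | S y < S x}, ‖f y‖ₑ ∂μ) ^ q * ENNReal.ofReal (S x ^ α) ∂μ := by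
    rw [hU, ← lintegral_const_mul' _ _ (ENNReal.rpow_ne_top_of_nonneg hq.le hVtop)]
    refine le_trans (setLIntegral_mono_ae' hmR (ae_of_all _ fun x hx => ?_))
      (setLIntegral_le_lintegral _ _)
    gcongr
    simp only [hfe]
    rw [hV, ← lintegral_indicator hmA, setLIntegral_indicator hmA, lintegral_indicator hmA,
      inter_eq_left.2]
    intro y hy
    exact lt_trans hy.2 hx.1
  have hmain := (ENNReal.rpow_le_rpow hL (by positivity)).trans (hC f hfm)
  rw [hR, ENNReal.mul_rpow_of_nonneg _ _ (by positivity), ← ENNReal.rpow_mul,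
    mul_one_div_cancel hq.ne', ENNReal.rpow_one] at hmain
  have hsplit : V = V ^ (1 / p') * V ^ (1 / p) := by
    rw [← ENNReal.rpow_add _ _ hV0 hVtop, one_div, one_div, hpp.symm.inv_add_inv_eq_one,
      ENNReal.rpow_one]
  rw [← ENNReal.mul_le_mul_iff_left (c := V ^ (1 / p))]
  · refine le_trans (le_of_eq ?_) hmain
    conv_rhs => rw [hsplit]
    ring
  · exact (ENNReal.rpow_pos (pos_iff_ne_zero.2 hV0) hVtop).ne'
  · exact ENNReal.rpow_ne_top_of_nonneg (by positivity) hVtop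

/-- The weighted Hardy inequality with power weights in `S` holds exactly for balanced exponents. -/
theorem hardy_iff [SFinite μ] (h : IsHyperbolicRadius μ S n c) {p p' q α β : ℝ}
    (hpp : p.HolderConjugate p') (hpq : p ≤ q) :
    (∃ C : ℝ, 0 < C ∧ ∀ f : X → ℂ, Measurable f →
      (∫⁻ x, (∫⁻ y in {y | S y < S x}, ‖f y‖ₑ ∂μ) ^ q * ENNReal.ofReal (S x ^ α) ∂μ) ^ (1 / q) ≤
        ENNReal.ofReal C * (∫⁻ x, ‖f x‖ₑ ^ p * ENNReal.ofReal (S x ^ β) ∂μ) ^ (1 / p)) ↔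
    α + n < 1 ∧ 0 < β * (1 - p') + n ∧ 0 ≤ (α + n) / q + (β * (1 - p') + n) / p' ∧
      (α + n) / q + (β * (1 - p') + n) / p' ≤ 1 / q + 1 / p' := by
  have hp := hpp.pos
  have hq : 0 < q := by linarith
  constructor
  · rintro ⟨C, hC0, hC⟩
    exact conditions_of_powMass_le h.ne_zero h.ne_top hq hpp.symm.pos hC0.le
      fun l r R hl hlr _ => h.powMass_le_of_hardy_le hpp hq hC hl hlr
  · rintro ⟨h1, h2, h3, h4⟩
    obtain ⟨C, hC0, hC⟩ := h.exists_hardy_le hpp hpq h1 h2 h3 h4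
    -- The `+ 1` makes the constant strictly positive, since `C` is only known to be nonnegative.
    refine ⟨(C + 1) ^ (1 / q), by positivity, fun f hf => ?_⟩
    refine (ENNReal.rpow_le_rpow (hC (fun x => ‖f x‖ₑ) hf.enorm) (by positivity)).trans ?_
    rw [ENNReal.mul_rpow_of_nonneg _ _ (by positivity), ← ENNReal.rpow_mul,
      ← ENNReal.ofReal_rpow_of_nonneg (by positivity) (by positivity)]
    have : q / p * (1 / q) = 1 / p := by field_simp
    rw [this]
    gcongr
    linarith

end IsHyperbolicRadius

end RadialHardy

theorem corollary3p2 (n : ℕ) (hn : 1 ≤ n) (a : HyperbolicSpace n)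
    (p p' q α β : ℝ) (hp : 1 < p) (hpq : p ≤ q) (hp' : 1 / p + 1 / p' = 1) :
    (∃ C : ℝ, 0 < C ∧ ∀ f : HyperbolicSpace n → ℂ, Measurable f →
      (∫⁻ x, (∫⁻ y in HyperbolicSpace.ball a (dist a x), ‖f y‖ₑ) ^ q *
          ENNReal.ofReal (Real.sinh (dist a x) ^ α)) ^ (1 / q) ≤
        ENNReal.ofReal C *
          (∫⁻ x, ‖f x‖ₑ ^ p * ENNReal.ofReal (Real.sinh (dist a x) ^ β)) ^ (1 / p)) ↔
    ((0 ≤ α + n ∧ α + n < 1 ∧ 0 < β * (1 - p') + n ∧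
        (α + n) / q + (β * (1 - p') + n) / p' ≤ 1 / q + 1 / p') ∨
      (α + n < 0 ∧ 0 < β * (1 - p') + n ∧
        0 ≤ (α + n) / q + (β * (1 - p') + n) / p' ∧
        (α + n) / q + (β * (1 - p') + n) / p' ≤ 1 / q + 1 / p')) := by
  have hpp : p.HolderConjugate p' := by
    rw [Real.holderConjugate_iff]
    exact ⟨hp, by simpa using hp'⟩
  have hq : 0 < q := by linarith
  obtain ⟨c, hc0, hc, hlaw⟩ := HyperbolicSpace.exists_lintegral_sinh_dist_eq hn a
  have hrad : RadialHardy.IsHyperbolicRadius (volume : Measure (HyperbolicSpace n))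
      (fun x => Real.sinh (dist a x)) n c :=
    ⟨Real.measurable_sinh.comp (HyperbolicSpace.measurable_dist a), hc0, hc, hlaw⟩
  have hball : ∀ x, HyperbolicSpace.ball a (dist a x) =
      {y | Real.sinh (dist a y) < Real.sinh (dist a x)} := by
    intro x
    ext y
    exact Real.sinh_lt_sinh.symm
  simp only [hball]
  rw [hrad.hardy_iff hpp hpq]
  constructor
  · rintro ⟨h1, h2, h3, h4⟩
    rcases le_or_gt 0 (α + n) with h0 | h0
    · exact Or.inl ⟨h0, h1, h2, h4⟩
    · exact Or.inr ⟨h0, h2, h3, h4⟩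
  · rintro (⟨h0, h1, h2, h4⟩ | ⟨h0, h2, h3, h4⟩)
    -- In case (A) the lower balance condition is automatic, both summands being nonnegative.
    · have := hpp.symm.pos
      exact ⟨h1, h2, by positivity, h4⟩
    · exact ⟨by linarith, h2, h3, h4⟩
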